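/- **Conventions.** Alphabets are finite. The size $|\mathcal R|$ of a finite representation $\mathcal R$ of a language is the length of its usual binary encoding. A class $\mathcal C_1$ of representations *can be exponentially more succinct* than a class $\mathcal C_2$ if for every function $f\in 2^{o(n)}$ there is $\mathcal R_1\in\mathcal C_1$ such that every $\mathcal R_2\in\mathcal C_2$ representing the same language (over the same alphabet) as $\mathcal R_1$ satisfies $|\mathcal R_2|>f(|\mathcal R_1|)$. *UHATs.* A masked unique hard-attention transformer (UHAT) over $\Sigma$ consists of a token embedding $\Sigma\to\mathbb Q^d$ ($d>0$), a finite sequence of UHA layers and ReLU layers of matching widths, an acceptance vector $t\in\mathbb Q^s$ and an output position (first or last). A UHA layer of width $r>0$ is given by rational affine maps $A,B:\mathbb Q^r\to\mathbb Q^r$, $C:\mathbb Q^{2r}\to\mathbb Q^{s'}$, a mask $M(i,j)$ (always true, $j<i$, or $j>i$) and a tie-breaking rule $\tau\in\{\min,\max\}$. It maps $v_1,\dots,v_n$ to $C(v_1,a_1),\dots,C(v_n,a_n)$, where $a_i=v_{\tau(B_i)}$, $B_i$ is the set of those $j$ with $M(i,j)$ that maximize $\langle A(v_i),B(v_j)\rangle$,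 and $a_i=0$ if there is no $j$ with $M(i,j)$. A ReLU layer replaces a fixed coordinate $x$ of each vector by $\max\{0,x\}$. A non-empty word is accepted iff $\langle t,v\rangle>0$ for the output vector $v$ at the output position; the empty word is not accepted. *Fixed-precision RNNs.* A recurrent neural network (RNN) over $\Sigma$ with precision $k$ and dimension $d$ consists of an initial vector $x_0\in(\{0,1\}^k)^d$, a token embedding $\mathrm{emb}:\Sigma\to(\{0,1\}^k)^e$, an update function $g:(\{0,1\}^k)^d\times(\{0,1\}^k)^e\to(\{0,1\}^k)^d$ and a final function $(\{0,1\}^k)^d\to\{\mathrm{Acc},\mathrm{Rej}\}$. It accepts $a_1\cdots a_n$ iff the final function accepts $x_n$, where $x_{i+1}=g(x_i,\mathrm{emb}(a_{i+1}))$. Its binary encoding lists $k$ in unary, the dimensions, the embedding, $x_0$, and code words (bit strings) for the update and the final function; the code in which these functions are written is arbitrary and may differ between RNNs. **Statement.** 1. Every RNN with precision $k$ and dimension $d$ recognizes the same language as some deterministic finite automaton with $2^{kd}$ states. 2. UHATs can be exponentially more succinct than fixed-precision RNNs: for every $f\in 2^{o(n)}$ there is a UHAT $\mathcal T$ such that every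 fixed-precision RNN $\mathcal R$ recognizing the same language as $\mathcal T$ satisfies $|\mathcal R|>f(|\mathcal T|)$. -/

import Mathlib

namespace Succinct

/-- A class of finite representations of languages. The alphabet of a representation is
`Fin σ` for some `σ`; every representation has a binary encoding and denotes a language. -/
structure RepClass where
  Rep : ℕ → Type
  lang : {σ : ℕ} → Rep σ → Language (Fin σ)
  encode : {σ : ℕ} → Rep σ → List Bool

/-- The size of a representation is the length of its binary encoding. -/
def RepClass.size (C : RepClass) {σ : ℕ} (R : C.Rep σ) : ℕ := (C.encode R).length

/-- `f ∈ 2^{o(n)}`. -/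
def InTwoPowLittleO (f : ℕ → ℝ) : Prop :=
  ∃ g : ℕ → ℝ, g =o[Filter.atTop] (fun n : ℕ => (n : ℝ)) ∧ ∀ n, f n ≤ (2 : ℝ) ^ g n

/-- `C₁` can be exponentially more succinct than `C₂`. -/
def CanBeExpMoreSuccinct (C₁ C₂ : RepClass) : Prop :=
  ∀ f : ℕ → ℝ, InTwoPowLittleO f →
    ∃ (σ : ℕ) (R₁ : C₁.Rep σ), ∀ R₂ : C₂.Rep σ,
      C₂.lang R₂ = C₁.lang R₁ → f (C₁.size R₁) < (C₂.size R₂ : ℝ)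

section Encodings

/-- Self-delimiting code of a bit string: every bit is preceded by `true`, and a `false` marks
the end. -/
def encBits (l : List Bool) : List Bool := l.flatMap (fun b => [true, b]) ++ [false]

/-- Binary code of a natural number. -/
def encNat (n : ℕ) : List Bool := encBits n.bits

/-- Unary code of a natural number. -/
def encUnary (n : ℕ) : List Bool := List.replicate n true ++ [false]

/-- Binary code of a rational number: sign, numerator and denominator. -/
def encRat (q : ℚ) : List Bool :=
  decide (q.num < 0) :: (encNat q.num.natAbs ++ encNat q.den)

/-- Concatenation of the codes of the entries of a family. -/
def encFam {α : Type} {n : ℕ} (enc : α → List Bool) (v : Fin n → α) : List Bool :=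
  (List.ofFn (fun i => enc (v i))).flatten

end Encodings

section Transformers

/-- An affine transformation `x ↦ Q x + b` with rational coefficients. -/
structure Affine (m n : ℕ) where
  mat : Matrix (Fin n) (Fin m) ℚ
  bias : Fin n → ℚ

def Affine.apply {m n : ℕ} (T : Affine m n) (x : Fin m → ℚ) : Fin n → ℚ :=
  T.mat.mulVec x + T.bias

def Affine.encode {m n : ℕ} (T : Affine m n) : List Bool :=
  encFam (fun row : Fin m → ℚ => encFam encRat row) T.mat ++ encFam encRat T.bias

/-- Mask predicates: no masking, strict future masking (`j < i`), strict past masking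
(`j > i`). -/
inductive Mask
  | noMask
  | strictFuture
  | strictPast

/-- `M.allows i j`: position `i` may attend to position `j`. -/
def Mask.allows : Mask → ℕ → ℕ → Bool
  | .noMask, _, _ => true
  | .strictFuture, i, j => decide (j < i)
  | .strictPast, i, j => decide (i < j)

def Mask.encode : Mask → List Bool
  | .noMask => [false, false]
  | .strictFuture => [true, false]
  | .strictPast => [true, true]

/-- Tie-breaking functions `min` and `max`. -/
inductive TieBreak
  | leftmost
  | rightmost

def TieBreak.select {n : ℕ} : TieBreak → (s : Finset (Fin n)) → s.Nonempty → Fin n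
  | .leftmost, s, h => s.min' h
  | .rightmost, s, h => s.max' h

def TieBreak.encode : TieBreak → List Bool
  | .leftmost => [false]
  | .rightmost => [true]

/-- A masked unique hard-attention layer of width `r` and output dimension `s`. -/
structure UHALayer (r s : ℕ) where
  width_pos : 0 < r
  A : Affine r r
  B : Affine r r
  C : Affine (r + r) s
  mask : Mask
  tie : TieBreak

namespace UHALayer

variable {r s n : ℕ} (L : UHALayer r s) (v : Fin n → Fin r → ℚ)

/-- The score function `⟨A(v_i), B(v_j)⟩`. -/
def score (i j : Fin n) : ℚ := dotProduct (L.A.apply (v i)) (L.B.apply (v j))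

/-- The set `U_i` of unmasked positions. -/
def unmasked (n : ℕ) (i : Fin n) : Finset (Fin n) :=
  Finset.univ.filter (fun j => L.mask.allows i j = true)

/-- The set `B_i` of unmasked positions that maximize the score. -/
def best (i : Fin n) : Finset (Fin n) :=
  (L.unmasked n i).filter (fun j => ∀ j' ∈ L.unmasked n i, L.score v i j' ≤ L.score v i j)

theorem best_nonempty (i : Fin n) (h : (L.unmasked n i).Nonempty) : (L.best v i).Nonempty := by
  obtain ⟨j, hj, hmax⟩ := Finset.exists_max_image _ (L.score v i) h
  exact ⟨j, Finset.mem_filter.mpr ⟨hj, hmax⟩⟩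

/-- The attention vector at position `i`. -/
def attention (i : Fin n) : Fin r → ℚ :=
  if h : (L.unmasked n i).Nonempty then
    v (L.tie.select (L.best v i) (L.best_nonempty v i h))
  else 0

/-- The output sequence `C(v_1, a_1), …, C(v_n, a_n)`. -/
def run : Fin n → Fin s → ℚ :=
  fun i => L.C.apply (Fin.append (v i) (L.attention v i))

def encode : List Bool :=
  encNat s ++ L.A.encode ++ L.B.encode ++ L.C.encode ++ L.mask.encode ++ L.tie.encode

end UHALayer

/-- The ReLU layer on coordinate `k`. -/
def reluRun {r n : ℕ} (k : Fin r) (v : Fin n → Fin r → ℚ) : Fin n → Fin r → ℚ :=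
  fun i => Function.update (v i) k (max 0 (v i k))

/-- A sequence of UHA layers and ReLU layers of matching width, from dimension `r` to
dimension `t`. -/
inductive Layers : ℕ → ℕ → Type
  | nil (r : ℕ) : Layers r r
  | uha {r s t : ℕ} (L : UHALayer r s) (rest : Layers s t) : Layers r t
  | relu {r t : ℕ} (k : Fin r) (rest : Layers r t) : Layers r t

/-- Application of the layers, the head of the sequence first. -/
def Layers.run {n : ℕ} : {r t : ℕ} → Layers r t → (Fin n → Fin r → ℚ) → (Fin n → Fin t → ℚ)
  | _, _, .nil _, v => v
  | _, _, .uha L rest, v => rest.run (L.run v)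
  | _, _, .relu k rest, v => rest.run (reluRun k v)

def Layers.encode : {r t : ℕ} → Layers r t → List Bool
  | _, _, .nil _ => [false]
  | _, _, .uha L rest => [true, false] ++ L.encode ++ rest.encode
  | _, _, .relu k rest => [true, true] ++ encNat k ++ rest.encode

/-- The output position: first or last. -/
inductive OutPos
  | first
  | last

def OutPos.index {n : ℕ} (h : 0 < n) : OutPos → Fin n
  | .first => ⟨0, h⟩
  | .last => ⟨n - 1, Nat.sub_lt h Nat.one_pos⟩

def OutPos.encode : OutPos → List Bool
  | .first => [false]
  | .last => [true]

/-- A masked unique hard-attention transformer over the alphabet `Fin σ`, given with its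
acceptance vector and its output position. -/
structure UHAT (σ : ℕ) where
  d : ℕ
  d_pos : 0 < d
  s : ℕ
  emb : Fin σ → Fin d → ℚ
  layers : Layers d s
  acc : Fin s → ℚ
  out : OutPos

namespace UHAT

variable {σ : ℕ} (T : UHAT σ)

/-- The output sequence on the word `w`. -/
def run (w : List (Fin σ)) : Fin w.length → Fin T.s → ℚ :=
  T.layers.run (fun i => T.emb (w.get i))

/-- The recognized language. The empty word has no output position and is not accepted. -/
def lang : Language (Fin σ) :=
  {w | ∃ h : 0 < w.length, 0 < dotProduct T.acc (T.run w (T.out.index h))}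

def encode : List Bool :=
  encNat σ ++ encNat T.d ++ encFam (fun x : Fin T.d → ℚ => encFam encRat x) T.emb ++
    T.layers.encode ++ encFam encRat T.acc ++ T.out.encode

end UHAT

/-- The class of UHATs. -/
def uhatClass : RepClass where
  Rep := UHAT
  lang := fun T => T.lang
  encode := fun T => T.encode

end Transformers

section RecurrentNetworks

/-- `d`-vectors of numbers with `k` bits of precision. -/
abbrev FPVec (k d : ℕ) : Type := Fin d → Fin k → Bool

/-- A way to write down the functions of recurrent networks as bit strings: for precision `k`,
state dimension `d` and embedding dimension `e`, a bit string (for instance a list of weights for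
some fixed architecture and arithmetic) denotes an update function, and another one denotes a
final function. Nothing is assumed about it, so every architecture, every number format and every
rounding mode is covered. -/
structure RNNFormat where
  step : (k d e : ℕ) → List Bool → FPVec k d → FPVec k e → FPVec k d
  final : (k d : ℕ) → List Bool → FPVec k d → Bool

/-- A recurrent neural network with fixed precision over the alphabet `Fin σ`, its functions
being written in the format `F`. -/
structure RNN (F : RNNFormat) (σ : ℕ) where
  precision : ℕ
  dim : ℕ
  embDim : ℕ
  emb : Fin σ → FPVec precision embDim
  init : FPVec precision dim
  stepCode : List Bool
  finalCode : List Bool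

namespace RNN

variable {F : RNNFormat} {σ : ℕ} (R : RNN F σ)

/-- The update function `g`, composed with the token embedding. -/
def step (x : FPVec R.precision R.dim) (a : Fin σ) : FPVec R.precision R.dim :=
  F.step R.precision R.dim R.embDim R.stepCode x (R.emb a)

/-- The state `x_n` reached on a word of length `n`. -/
def state (w : List (Fin σ)) : FPVec R.precision R.dim := w.foldl R.step R.init

/-- The accepted language. -/
def lang : Language (Fin σ) :=
  {w | F.final R.precision R.dim R.finalCode (R.state w) = true}

/-- The binary encoding, with the precision in unary. -/
def encode : List Bool :=
  encUnary R.precision ++ encNat σ ++ encNat R.dim ++ encNat R.embDim ++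
    encFam (fun x : FPVec R.precision R.embDim => encFam List.ofFn x) R.emb ++
    encFam List.ofFn R.init ++ encBits R.stepCode ++ encBits R.finalCode

end RNN

/-- The class of fixed-precision RNNs, in all formats. -/
def rnnClass : RepClass where
  Rep := fun σ => Σ F : RNNFormat, RNN F σ
  lang := fun R => R.2.lang
  encode := fun R => R.2.encode

end RecurrentNetworks

end Succinct

/-! The state of an RNN is one of `2 ^ (k * d)` bit arrays, so the network is itself an automaton.
As the initial vector is part of the encoding, the size is at least `k * d`, whatever the format. A
language with `2 ^ (2 ^ N)` pairwise distinguishable prefixes therefore forces size at least `2 ^ N`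
(`RNN.two_pow_le_size_of_lang_eq`).

Such a language over three letters asks whether the last `N`-bit block differs from all earlier
blocks: a prefix has to remember the set of its blocks. A UHAT of size linear in `N` recognizes it.
Each of `N + 1` layers of constant size shifts one more letter into a number `w` attached to every
position (`WindowInvariant.shift`). The final layer looks for an earlier separator with the same
number by maximizing `w_i ^ 2 - (w_i - w_j) ^ 2 + 2 * sep_j` (`matchLayers_pos_iff`). This score has
to be bilinear, so `w ^ 2` is carried along with `w`; its update needs only products of a bit and a
number in `[0, 1)`, which one ReLU computes. -/

namespace Succinct

/-! ### RNNs as automata, and a Myhill–Nerode bound on their size. -/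

section RecurrentNetworkBounds

variable {F : RNNFormat} {σ : ℕ} (R : RNN F σ)

theorem card_fpVec (k d : ℕ) : Fintype.card (FPVec k d) = 2 ^ (k * d) := by
  simp [FPVec, pow_mul]

/-- The deterministic automaton whose states are the states of the network. -/
def RNN.toDFA : DFA (Fin σ) (FPVec R.precision R.dim) where
  step := R.step
  start := R.init
  accept := {x | F.final R.precision R.dim R.finalCode x = true}

theorem RNN.exists_dfa :
    ∃ A : DFA (Fin σ) (Fin (2 ^ (R.precision * R.dim))), A.accepts = R.lang := by
  refine ⟨DFA.reindex (Fintype.equivFinOfCardEq (card_fpVec _ _)) R.toDFA, ?_⟩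
  rw [DFA.accepts_reindex]
  rfl

theorem length_encFam_ofFn {k d : ℕ} (v : Fin d → Fin k → Bool) :
    (encFam List.ofFn v).length = k * d := by
  simp [encFam, List.length_flatten, List.map_ofFn, Function.comp_def, mul_comm]

/-- The initial vector alone is written with this many bits; the function codes play no role. -/
theorem RNN.precision_mul_dim_le_length_encode :
    R.precision * R.dim ≤ R.encode.length := by
  simp only [RNN.encode, List.length_append, length_encFam_ofFn R.init]
  omega

/-- Pairwise distinguishable prefixes lead to different states. -/
theorem RNN.card_le_of_distinguishable {ι : Type*} [Fintype ι] (p : ι → List (Fin σ))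
    (h : ∀ i j, i ≠ j → ∃ z, ¬(p i ++ z ∈ R.lang ↔ p j ++ z ∈ R.lang)) :
    Fintype.card ι ≤ 2 ^ (R.precision * R.dim) := by
  rw [← card_fpVec]
  refine Fintype.card_le_of_injective (fun i => R.state (p i)) fun i j hij => ?_
  by_contra hne
  obtain ⟨z, hz⟩ := h i j hne
  apply hz
  have : R.state (p i ++ z) = R.state (p j ++ z) := by
    simp only [RNN.state, List.foldl_append] at hij ⊢
    rw [hij]
  change F.final _ _ _ _ = true ↔ F.final _ _ _ _ = true
  rw [this]

end RecurrentNetworkBounds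

/-! ### Window values and the language of fresh blocks. -/

section Window

/-- The binary digit of a letter; the letter `2` is the separator. -/
def digit (a : Fin 3) : ℚ := if a = 1 then 1 else 0

/-- The value of a letter as a separator flag. -/
def sepFlag (a : Fin 3) : ℚ := if a = 2 then 1 else 0

/-- The number in `[0, 1)` whose binary expansion is given by the first `t` letters. -/
def windowValue : ℕ → List (Fin 3) → ℚ
  | 0, _ => 0
  | _ + 1, [] => 0
  | t + 1, a :: l => (digit a + windowValue t l) / 2

theorem windowValue_nil (t : ℕ) : windowValue t [] = 0 := by cases t <;> rfl

theorem digit_eq_zero_or_one (a : Fin 3) : digit a = 0 ∨ digit a = 1 := by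
  unfold digit; split_ifs <;> simp

theorem windowValue_mem : ∀ (t : ℕ) (l : List (Fin 3)),
    0 ≤ windowValue t l ∧ windowValue t l < 1
  | 0, _ => by simp [windowValue]
  | _ + 1, [] => by simp [windowValue]
  | t + 1, a :: l => by
    have := windowValue_mem t l
    rw [windowValue]
    rcases digit_eq_zero_or_one a with h | h <;> rw [h] <;> constructor <;> linarith

/-- The letters of a binary word. -/
def bitLetters (x : List Bool) : List (Fin 3) := x.map (fun b => if b then 1 else 0)

/-- Twice the value is the leading digit plus a number in `[0, 1)`, so the digit is its integer part
and can be peeled off. -/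
theorem windowValue_bitLetters_inj : ∀ (x y : List Bool) (r s : List (Fin 3)),
    x.length = y.length →
    windowValue x.length (bitLetters x ++ r) = windowValue y.length (bitLetters y ++ s) → x = y
  | [], [], _, _, _, _ => rfl
  | a :: x, b :: y, r, s, hl, h => by
    have hl' : x.length = y.length := by simpa using hl
    have hx := windowValue_mem x.length (bitLetters x ++ r)
    have hy := windowValue_mem y.length (bitLetters y ++ s)
    have key : digit (if a then 1 else 0) + windowValue x.length (bitLetters x ++ r) =
        digit (if b then 1 else 0) + windowValue y.length (bitLetters y ++ s) := by
      have h' : (digit (if a then 1 else 0) + windowValue x.length (bitLetters x ++ r)) / 2 =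
        (digit (if b then 1 else 0) + windowValue y.length (bitLetters y ++ s)) / 2 := h
      linarith
    have hab : a = b := by
      cases a <;> cases b <;> simp [digit] at key ⊢ <;> linarith
    subst hab
    rw [windowValue_bitLetters_inj x y r s hl' (by linarith)]

theorem windowValue_bitLetters_append : ∀ (x : List Bool) (r s : List (Fin 3)),
    windowValue x.length (bitLetters x ++ r) = windowValue x.length (bitLetters x ++ s)
  | [], _, _ => rfl
  | a :: x, r, s => by
    have := windowValue_bitLetters_append x r s
    change (_ + windowValue x.length (bitLetters x ++ r)) / 2 =
      (_ + windowValue x.length (bitLetters x ++ s)) / 2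
    rw [this]

theorem bitLetters_reverse (x : List Bool) : (bitLetters x).reverse = bitLetters x.reverse := by
  simp [bitLetters]

theorem two_notMem_bitLetters (x : List Bool) : (2 : Fin 3) ∉ bitLetters x := by
  simp only [bitLetters, List.mem_map, not_exists, not_and]
  intro b _
  cases b <;> decide

/-- Concatenation of binary words, each one followed by a separator. -/
def blocks (xs : List (List Bool)) : List (Fin 3) := xs.flatMap (fun x => bitLetters x ++ [2])

theorem blocks_cons (x : List Bool) (xs : List (List Bool)) :
    blocks (x :: xs) = bitLetters x ++ 2 :: blocks xs := by simp [blocks]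

theorem blocks_append (xs ys : List (List Bool)) :
    blocks (xs ++ ys) = blocks xs ++ blocks ys := by simp [blocks]

/-- Blocks contain no separator themselves, so every occurrence of `2` closes a block. -/
theorem eq_blocks_of_append_eq_blocks : ∀ (xs : List (List Bool)) (u v : List (Fin 3)),
    u ++ 2 :: v = blocks xs →
    ∃ l y r, xs = l ++ y :: r ∧ u = blocks l ++ bitLetters y ∧ v = blocks r
  | [], u, v, h => by simp [blocks] at h
  | x :: xs, u, v, h => by
    rw [blocks_cons, List.append_eq_append_iff] at h
    have hx := two_notMem_bitLetters x
    rcases h with ⟨c, h1, h2⟩ | ⟨c, h1, h2⟩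
    · cases c with
      | nil =>
        simp only [List.nil_append, List.cons.injEq, true_and] at h2
        exact ⟨[], x, xs, rfl, by simpa [blocks] using h1.symm, h2⟩
      | cons c cs =>
        simp only [List.cons_append, List.cons.injEq] at h2
        rw [h1, ← h2.1] at hx
        simp at hx
    · cases c with
      | nil =>
        simp only [List.nil_append, List.cons.injEq, true_and] at h2
        exact ⟨[], x, xs, rfl, by simpa [blocks] using h1, h2.symm⟩
      | cons c cs =>
        simp only [List.cons_append, List.cons.injEq] at h2
        obtain ⟨l, y, r, e1, e2, e3⟩ := eq_blocks_of_append_eq_blocks xs cs v h2.2.symm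
        refine ⟨x :: l, y, r, by simp [e1], ?_, e3⟩
        rw [h1, blocks_cons, e2, ← h2.1]
        simp

/-- The words whose last window does not occur before an earlier separator. -/
def FreshWindow (t : ℕ) (w : List (Fin 3)) : Prop :=
  ∀ u v, v ≠ [] → w = u ++ 2 :: v →
    windowValue t (2 :: u.reverse) ≠ windowValue t w.reverse

/-- The window is read backwards from a separator, which takes up one digit; hence length `N + 1`
for blocks of `N` bits, which appear reversed. -/
theorem freshWindow_blocks_iff {N : ℕ} (xs : List (List Bool)) (x : List Bool)
    (hxs : ∀ y ∈ xs, y.length = N) (hx : x.length = N) :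
    FreshWindow (N + 1) (blocks xs ++ blocks [x]) ↔ x ∉ xs := by
  have hrev : ∀ (l : List (List Bool)) (y : List Bool),
      (2 : Fin 3) :: (blocks l ++ bitLetters y).reverse =
        2 :: (bitLetters y.reverse ++ (blocks l).reverse) := by
    intro l y
    rw [List.reverse_append, bitLetters_reverse]
  have hlast : (blocks xs ++ blocks [x]).reverse =
      2 :: (bitLetters x.reverse ++ (blocks xs).reverse) := by
    rw [← hrev]
    simp [blocks]
  constructor
  · intro h hmem
    obtain ⟨l, r, rfl⟩ := List.append_of_mem hmem
    refine h (blocks l ++ bitLetters x) (blocks r ++ blocks [x]) ?_ ?_ ?_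
    · simp [blocks]
    · simp [blocks_append, blocks_cons]
    · rw [hlast, hrev, windowValue, windowValue]
      have := windowValue_bitLetters_append x.reverse (blocks l).reverse
        (blocks (l ++ x :: r)).reverse
      rw [List.length_reverse, hx] at this
      rw [this]
  · intro hmem u v hv hw heq
    rw [← blocks_append] at hw
    obtain ⟨l, y, r, h1, rfl, rfl⟩ := eq_blocks_of_append_eq_blocks _ _ _ hw.symm
    -- An empty `r` would mean the final separator, which `v ≠ []` excludes; otherwise `y` is one of
    -- the earlier blocks.
    rcases List.eq_nil_or_concat r with rfl | ⟨r', z, rfl⟩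
    · exact hv rfl
    · have hsplit := List.append_inj'
        (show xs ++ [x] = (l ++ y :: r') ++ [z] by simpa using h1) rfl
      have hy : y ∈ xs := by rw [hsplit.1]; simp
      rw [hlast, hrev, windowValue, windowValue] at heq
      have hN := hxs y hy
      have : y.reverse = x.reverse := by
        refine windowValue_bitLetters_inj _ _ _ _ (by simp [hN, hx])
          (by simp only [List.length_reverse, hN, hx]; linarith)
      exact hmem (List.reverse_injective this ▸ hy)

end Window

/-! ### The transformer, its size and its correctness. -/

section Construction

/-- The affine map `(v, a) ↦ P v + Q a + c`. -/
def Affine.ofPair {r s : ℕ} (P Q : Matrix (Fin s) (Fin r) ℚ) (c : Fin s → ℚ) :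
    Affine (r + r) s where
  mat := fun k => Fin.append (P k) (Q k)
  bias := c

theorem Affine.ofPair_apply {r s : ℕ} (P Q : Matrix (Fin s) (Fin r) ℚ) (c : Fin s → ℚ)
    (v a : Fin r → ℚ) (k : Fin s) :
    (Affine.ofPair P Q c).apply (Fin.append v a) k = P.mulVec v k + Q.mulVec a k + c k := by
  simp only [Affine.ofPair, Affine.apply, Matrix.mulVec, dotProduct, Pi.add_apply]
  rw [Fin.sum_univ_add]
  simp only [Fin.append_left, Fin.append_right]

/-- The layer that prepends the digit at a position to the window of the preceding position.
The coordinates are the digit, the separator flag, the window value `w`, and two numbers `p`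
and `z` with `p + z / 2 = w ^ 2`. -/
def shiftLayer : UHALayer 5 5 where
  width_pos := by norm_num
  A := ⟨0, 0⟩
  B := ⟨0, 0⟩
  C := Affine.ofPair
    !![1, 0, 0, 0, 0; 0, 1, 0, 0, 0; 1/2, 0, 0, 0, 0; 1/4, 0, 0, 0, 0; 1, 0, 0, 0, 0]
    !![0, 0, 0, 0, 0; 0, 0, 0, 0, 0; 0, 0, 1/2, 0, 0; 0, 0, 0, 1/4, 1/8; 0, 0, 1, 0, 0]
    ![0, 0, 0, 0, -1]
  mask := .strictFuture
  tie := .rightmost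

/-- The layer that attends to the separator whose window value is the closest one and outputs
the two differences of the window values, and `0` if a separator was found. -/
def matchLayer : UHALayer 5 3 where
  width_pos := by norm_num
  A := ⟨!![0, 0, 2, 0, 0; 0, 0, 0, 0, 0; 0, 0, 0, 0, 0; 0, 0, 0, 0, 0; 0, 0, 0, 0, 0],
    ![0, 1, 0, 0, 0]⟩
  B := ⟨!![0, 0, 1, 0, 0; 0, 2, 0, -1, -1/2; 0, 0, 0, 0, 0; 0, 0, 0, 0, 0; 0, 0, 0, 0, 0], 0⟩
  C := Affine.ofPair
    !![0, 0, 1, 0, 0; 0, 0, -1, 0, 0; 0, 0, 0, 0, 0]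
    !![0, 0, -1, 0, 0; 0, 0, 1, 0, 0; 0, -1, 0, 0, 0]
    ![0, 0, 1]
  mask := .strictFuture
  tie := .rightmost

def matchLayers : Layers 5 3 := .uha matchLayer (.relu 0 (.relu 1 (.nil 3)))

def shiftLayers : ℕ → Layers 5 3
  | 0 => matchLayers
  | t + 1 => .uha shiftLayer (.relu 4 (shiftLayers t))

/-- The transformer for the words with a fresh window of length `t`. -/
def freshWindowUHAT (t : ℕ) : UHAT 3 where
  d := 5
  d_pos := by norm_num
  s := 3
  emb := fun a => ![digit a, sepFlag a, 0, 0, 0]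
  layers := shiftLayers t
  acc := 1
  out := .last

/-- The parameter `t` only determines how often one fixed pair of layers is repeated. -/
theorem exists_length_encode_freshWindowUHAT :
    ∃ a b : ℕ, 0 < b ∧ ∀ t, (freshWindowUHAT t).encode.length = a + b * t := by
  obtain ⟨b, hb⟩ : ∃ b, b = 4 + shiftLayer.encode.length + (encNat ((4 : Fin 5) : ℕ)).length :=
    ⟨_, rfl⟩
  have hl : ∀ t, (shiftLayers t).encode.length = matchLayers.encode.length + b * t := by
    intro t
    induction t with
    | zero => rw [mul_zero, add_zero, shiftLayers]
    | succ t ih =>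
      simp only [shiftLayers, Layers.encode, List.length_append, ih, List.length_cons,
        List.length_nil, hb]
      ring
  refine ⟨(freshWindowUHAT 0).encode.length, b, by omega, fun t => ?_⟩
  have h0 := hl 0
  simp only [UHAT.encode, freshWindowUHAT, List.length_append, hl t, h0]
  ring

/-- The state of the computation after `t` shifts on the word `w`. -/
def WindowInvariant (w : List (Fin 3)) (t : ℕ) (v : Fin w.length → Fin 5 → ℚ) : Prop :=
  ∀ i, v i 0 = digit (w.get i) ∧ v i 1 = sepFlag (w.get i) ∧
    v i 2 = windowValue t (w.take (i + 1)).reverse ∧ v i 3 + v i 4 / 2 = v i 2 ^ 2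

theorem reverse_take_succ (w : List (Fin 3)) (i : Fin w.length) :
    (w.take (i + 1)).reverse = w.get i :: (w.take i).reverse := by
  rw [List.take_succ_eq_append_getElem i.2]
  simp

theorem mem_unmasked_strictFuture {r s n : ℕ} {L : UHALayer r s} (hL : L.mask = .strictFuture)
    (i j : Fin n) : j ∈ L.unmasked n i ↔ j < i := by
  simp [UHALayer.unmasked, hL, Mask.allows]

theorem attention_eq_zero {r s n : ℕ} {L : UHALayer r s} (hL : L.mask = .strictFuture)
    (v : Fin n → Fin r → ℚ) (i : Fin n) (hi : (i : ℕ) = 0) : L.attention v i = 0 := by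
  rw [UHALayer.attention, dif_neg]
  rintro ⟨j, hj⟩
  rw [mem_unmasked_strictFuture hL, Fin.lt_def] at hj
  omega

theorem exists_attention_eq {r s n : ℕ} {L : UHALayer r s} (hL : L.mask = .strictFuture)
    (v : Fin n → Fin r → ℚ) (i : Fin n) (hi : (i : ℕ) ≠ 0) :
    ∃ j < i, L.attention v i = v j ∧ ∀ j' < i, L.score v i j' ≤ L.score v i j := by
  have hne : (L.unmasked n i).Nonempty :=
    ⟨⟨0, by omega⟩, by rw [mem_unmasked_strictFuture hL, Fin.lt_def]; simp; omega⟩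
  have hmem : L.tie.select (L.best v i) (L.best_nonempty v i hne) ∈ L.best v i := by
    cases L.tie
    · exact Finset.min'_mem _ _
    · exact Finset.max'_mem _ _
  obtain ⟨hlt, hmax⟩ := Finset.mem_filter.1 hmem
  refine ⟨_, (mem_unmasked_strictFuture hL _ _).1 hlt, by rw [UHALayer.attention, dif_pos hne],
    fun j' hj' => hmax j' ((mem_unmasked_strictFuture hL i j').2 hj')⟩

/-- All scores are `0`, so tie-breaking to the right under the strict mask picks the predecessor. -/
theorem shiftLayer_attention {n : ℕ} (v : Fin n → Fin 5 → ℚ) (i j : Fin n)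
    (hij : (i : ℕ) = j + 1) : shiftLayer.attention v i = v j := by
  have hne : (shiftLayer.unmasked n i).Nonempty :=
    ⟨j, by rw [mem_unmasked_strictFuture rfl, Fin.lt_def]; omega⟩
  rw [UHALayer.attention, dif_pos hne]
  congr 1
  change (shiftLayer.best v i).max' _ = j
  have hscore : ∀ j', shiftLayer.score v i j' = 0 := by
    intro j'
    simp [UHALayer.score, shiftLayer, Affine.apply]
  apply le_antisymm
  · refine Finset.max'_le _ _ _ fun j' hj' => ?_
    rw [UHALayer.best, Finset.mem_filter, mem_unmasked_strictFuture rfl, Fin.lt_def] at hj'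
    rw [Fin.le_def]
    omega
  · refine Finset.le_max' _ _ (Finset.mem_filter.2 ⟨?_, fun j' _ => by rw [hscore, hscore]⟩)
    rw [mem_unmasked_strictFuture rfl, Fin.lt_def]
    omega

/-- With digit `d` and preceding value `w`, the square of `(d + w) / 2` is `d / 4 + d * w / 2 + w ^
2 / 4`, as `d ^ 2 = d`. The product `d * w` exists only after the ReLU, so it stays in a coordinate
of its own and is merged by the next affine map. -/
theorem WindowInvariant.shift {w : List (Fin 3)} {t : ℕ} {v : Fin w.length → Fin 5 → ℚ}
    (hv : WindowInvariant w t v) :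
    WindowInvariant w (t + 1) (reluRun 4 (shiftLayer.run v)) := by
  intro i
  obtain ⟨h0, h1, -, -⟩ := hv i
  have ha : shiftLayer.attention v i 2 = windowValue t (w.take i).reverse ∧
      shiftLayer.attention v i 3 + shiftLayer.attention v i 4 / 2 =
        shiftLayer.attention v i 2 ^ 2 := by
    rcases Nat.eq_zero_or_eq_succ_pred (i : ℕ) with hi | hi
    -- At the first position the default attention vector `0` fits the window of the empty prefix.
    · rw [attention_eq_zero rfl v i hi, hi]
      simp [windowValue_nil]
    · have hj : (i : ℕ) - 1 < w.length := by omega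
      rw [shiftLayer_attention v i ⟨i - 1, hj⟩ (by simpa using hi)]
      obtain ⟨-, -, h2, h3⟩ := hv ⟨i - 1, hj⟩
      refine ⟨?_, h3⟩
      rw [h2]
      congr 3
      exact hi.symm
  obtain ⟨ha2, ha3⟩ := ha
  have hw := windowValue_mem t (w.take i).reverse
  generalize hatt : shiftLayer.attention v i = a at ha2 ha3
  have hC : ∀ k, shiftLayer.run v i k = shiftLayer.C.apply (Fin.append (v i) a) k := by
    intro k
    rw [UHALayer.run, hatt]
  have e0 : shiftLayer.run v i 0 = v i 0 := by
    rw [hC, shiftLayer, Affine.ofPair_apply]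
    simp [Matrix.mulVec, dotProduct, Fin.sum_univ_succ]
  have e1 : shiftLayer.run v i 1 = v i 1 := by
    rw [hC, shiftLayer, Affine.ofPair_apply]
    simp [Matrix.mulVec, dotProduct, Fin.sum_univ_five]
  have e2 : shiftLayer.run v i 2 = v i 0 / 2 + a 2 / 2 := by
    rw [hC, shiftLayer, Affine.ofPair_apply]
    simp [Matrix.mulVec, dotProduct, Fin.sum_univ_five]
    ring
  have e3 : shiftLayer.run v i 3 = v i 0 / 4 + a 3 / 4 + a 4 / 8 := by
    rw [hC, shiftLayer, Affine.ofPair_apply]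
    simp [Matrix.mulVec, dotProduct, Fin.sum_univ_five]
    ring
  have e4 : shiftLayer.run v i 4 = v i 0 + a 2 - 1 := by
    rw [hC, shiftLayer, Affine.ofPair_apply]
    simp [Matrix.mulVec, dotProduct, Fin.sum_univ_five]
    ring
  -- A product with a bit is a ReLU, because the other factor lies in `[0, 1)`.
  have hz : max 0 (v i 0 + a 2 - 1) = v i 0 * a 2 := by
    rw [h0, ha2]
    rcases digit_eq_zero_or_one (w.get i) with h | h <;> rw [h]
    · rw [max_eq_left (by linarith)]; ring
    · rw [max_eq_right (by linarith)]; ring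
  have hsq : v i 0 ^ 2 = v i 0 := by
    rw [h0]
    rcases digit_eq_zero_or_one (w.get i) with h | h <;> rw [h] <;> norm_num
  have r4 : reluRun 4 (shiftLayer.run v) i 4 = v i 0 * a 2 := by
    rw [reluRun, Function.update_self, e4, hz]
  have rk : ∀ k : Fin 5, k ≠ 4 → reluRun 4 (shiftLayer.run v) i k = shiftLayer.run v i k := by
    intro k hk
    rw [reluRun, Function.update_of_ne hk]
  rw [r4, rk 0 (by decide), rk 1 (by decide), rk 2 (by decide), rk 3 (by decide), e0, e1, e2, e3]
  refine ⟨h0, h1, ?_, ?_⟩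
  · rw [reverse_take_succ, windowValue, h0, ha2]
    ring
  · linear_combination (1 / 4) * ha3 - (1 / 4) * hsq

theorem run_shiftLayers {w : List (Fin 3)} : ∀ (n t : ℕ) (v : Fin w.length → Fin 5 → ℚ),
    WindowInvariant w t v →
    ∃ v', WindowInvariant w (t + n) v' ∧ (shiftLayers n).run v = matchLayers.run v'
  | 0, _, v, hv => ⟨v, hv, rfl⟩
  | n + 1, t, v, hv => by
    obtain ⟨v', h1, h2⟩ := run_shiftLayers n (t + 1) _ hv.shift
    exact ⟨v', by rwa [Nat.add_right_comm] at h1, h2⟩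

theorem sepFlag_eq_zero_or_one (a : Fin 3) : sepFlag a = 0 ∨ sepFlag a = 1 := by
  unfold sepFlag; split_ifs <;> simp

theorem matchLayer_score {n : ℕ} (v : Fin n → Fin 5 → ℚ) (i j : Fin n) :
    matchLayer.score v i j = 2 * v i 2 * v j 2 + (2 * v j 1 - (v j 3 + v j 4 / 2)) := by
  simp [UHALayer.score, matchLayer, Affine.apply, dotProduct, Fin.sum_univ_five]
  ring

theorem dotProduct_run_matchLayers {n : ℕ} (v : Fin n → Fin 5 → ℚ) (i : Fin n) :
    dotProduct 1 (matchLayers.run v i) =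
      |v i 2 - matchLayer.attention v i 2| + (1 - matchLayer.attention v i 1) := by
  generalize hatt : matchLayer.attention v i = a
  have hC : ∀ k, matchLayer.run v i k = matchLayer.C.apply (Fin.append (v i) a) k := by
    intro k
    rw [UHALayer.run, hatt]
  have e0 : matchLayer.run v i 0 = v i 2 - a 2 := by
    rw [hC, matchLayer, Affine.ofPair_apply]
    simp [Matrix.mulVec, dotProduct, Fin.sum_univ_five]
    ring
  have e1 : matchLayer.run v i 1 = -(v i 2 - a 2) := by
    rw [hC, matchLayer, Affine.ofPair_apply]
    simp [Matrix.mulVec, dotProduct, Fin.sum_univ_five]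
    ring
  have e2 : matchLayer.run v i 2 = 1 - a 1 := by
    rw [hC, matchLayer, Affine.ofPair_apply]
    simp [Matrix.mulVec, dotProduct, Fin.sum_univ_five]
    ring
  have habs : max 0 (v i 2 - a 2) + max 0 (-(v i 2 - a 2)) = |v i 2 - a 2| := by
    rcases le_total 0 (v i 2 - a 2) with h | h
    · rw [max_eq_right h, max_eq_left (by linarith), abs_of_nonneg h, add_zero]
    · rw [max_eq_left h, max_eq_right (by linarith), abs_of_nonpos h, zero_add]
  simp only [matchLayers, Layers.run, dotProduct, Fin.sum_univ_three, reluRun, Pi.one_apply,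
    one_mul]
  rw [Function.update_self, Function.update_of_ne (by decide : (1 : Fin 3) ≠ 0),
    Function.update_of_ne (by decide : (0 : Fin 3) ≠ 1),
    Function.update_of_ne (by decide : (2 : Fin 3) ≠ 1),
    Function.update_of_ne (by decide : (2 : Fin 3) ≠ 0), Function.update_self,
    e0, e1, e2, habs]

/-- The score is at most `w_i ^ 2 + 2`, with equality exactly at separators of equal window value.
If there is one, attention selects such a position and the output is `0`; any other position makes
the flag term or the absolute value positive. -/
theorem matchLayers_pos_iff {w : List (Fin 3)} {t : ℕ} {v : Fin w.length → Fin 5 → ℚ}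
    (hv : WindowInvariant w t v) (i : Fin w.length) :
    0 < dotProduct 1 (matchLayers.run v i) ↔
      ∀ j < i, w.get j = 2 → v j 2 ≠ v i 2 := by
  rw [dotProduct_run_matchLayers]
  by_cases hi : (i : ℕ) = 0
  -- The default vector `0` has separator flag `0`, so the first position gives a positive output.
  · rw [attention_eq_zero rfl v i hi]
    have := abs_nonneg (v i 2 - (0 : Fin 5 → ℚ) 2)
    refine iff_of_true ?_ fun j hj => ?_
    · simp only [Pi.zero_apply] at this ⊢
      linarith
    · rw [Fin.lt_def] at hj
      omega
  obtain ⟨j, hj, hatt, hmax⟩ := exists_attention_eq (L := matchLayer) rfl v i hi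
  have hb : ∀ k, 0 ≤ v k 2 ∧ v k 2 < 1 := fun k => by
    rw [(hv k).2.2.1]
    exact windowValue_mem _ _
  have hscore : ∀ k, matchLayer.score v i k =
      v i 2 ^ 2 - (v i 2 - v k 2) ^ 2 + 2 * sepFlag (w.get k) := by
    intro k
    rw [matchLayer_score, (hv k).2.2.2, (hv k).2.1]
    ring
  rw [hatt, (hv j).2.1]
  have habs := abs_nonneg (v i 2 - v j 2)
  constructor
  · intro hpos k hk hsep heq
    have hm := hmax k hk
    have hfk : sepFlag (w.get k) = 1 := by rw [hsep]; rfl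
    rw [hscore, hscore, hfk, heq] at hm
    have hsq := sq_nonneg (v i 2 - v j 2)
    rcases sepFlag_eq_zero_or_one (w.get j) with h | h <;> rw [h] at hm hpos
    · linarith
    · have h0 : v i 2 - v j 2 = 0 := by
        rw [← sq_eq_zero_iff]
        linarith
      rw [h0] at hpos
      simp at hpos
  · intro hall
    rcases sepFlag_eq_zero_or_one (w.get j) with h | h <;> rw [h]
    · linarith
    · have hsep : w.get j = 2 := by
        by_contra hne
        rw [sepFlag, if_neg hne] at h
        norm_num at h
      have := abs_pos.2 (sub_ne_zero.2 (hall j hj hsep).symm)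
      linarith

theorem mem_lang_freshWindowUHAT (t : ℕ) (w : List (Fin 3)) (hw : w ≠ []) :
    w ∈ (freshWindowUHAT t).lang ↔ FreshWindow t w := by
  have hpos : 0 < w.length := List.length_pos_iff.2 hw
  have hinit : WindowInvariant w 0 (fun i => (freshWindowUHAT t).emb (w.get i)) := by
    intro i
    refine ⟨rfl, rfl, rfl, ?_⟩
    simp [freshWindowUHAT]
  obtain ⟨v, hv, hrun⟩ := run_shiftLayers t 0 _ hinit
  rw [Nat.zero_add] at hv
  have hlang : w ∈ (freshWindowUHAT t).lang ↔
      0 < dotProduct 1 (matchLayers.run v ⟨w.length - 1, Nat.sub_lt hpos Nat.one_pos⟩) := by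
    rw [← hrun]
    exact ⟨fun ⟨_, h⟩ => h, fun h => ⟨hpos, h⟩⟩
  rw [hlang, matchLayers_pos_iff hv]
  have hlast : v ⟨w.length - 1, Nat.sub_lt hpos Nat.one_pos⟩ 2 = windowValue t w.reverse := by
    rw [(hv _).2.2.1]
    congr 2
    exact List.take_of_length_le (by simp only; omega)
  rw [hlast]
  constructor
  · intro h u s hs hus
    have hslen := List.length_pos_iff.2 hs
    have hlen : w.length = u.length + 1 + s.length := by
      rw [hus]; simp; omega
    have hget : w.get ⟨u.length, by omega⟩ = 2 := by
      simp [hus]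
    have hne := h ⟨u.length, by omega⟩ (by rw [Fin.lt_def]; simp only; omega) hget
    rw [(hv _).2.2.1, reverse_take_succ, hget] at hne
    convert hne using 4
    simp [hus]
  · intro h j hj hsep
    rw [(hv _).2.2.1, reverse_take_succ, hsep]
    rw [Fin.lt_def] at hj
    simp only at hj
    refine h (w.take j) (w.drop (j + 1)) ?_ ?_
    · rw [← List.length_pos_iff, List.length_drop]
      omega
    · have hget : w[(j : ℕ)] = 2 := hsep
      rw [← hget, ← List.drop_eq_getElem_cons, List.take_append_drop]

end Construction

/-! ### The lower bound for RNNs and the comparison of sizes. -/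

theorem RNN.two_pow_le_size_of_lang_eq {N : ℕ} {F : RNNFormat} (R : RNN F 3)
    (h : R.lang = (freshWindowUHAT (N + 1)).lang) : 2 ^ N ≤ R.encode.length := by
  -- One prefix for each set `S` of `N`-bit words; appending the block of `x` tests whether `x` is
  -- in `S`.
  let code (S : Finset (Fin N → Bool)) : List (List Bool) := S.toList.map List.ofFn
  have hmem : ∀ (S : Finset (Fin N → Bool)) (x : Fin N → Bool),
      blocks (code S) ++ blocks [List.ofFn x] ∈ R.lang ↔ x ∉ S := by
    intro S x
    rw [h, mem_lang_freshWindowUHAT _ _ (by simp [blocks]),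
      freshWindow_blocks_iff _ _ (by simp [code]) (by simp)]
    simp [code, List.ofFn_injective.eq_iff]
  have hcard := R.card_le_of_distinguishable (fun S => blocks (code S)) fun S S' hne => by
    obtain ⟨x, hx⟩ : ∃ x, ¬(x ∈ S ↔ x ∈ S') := by
      by_contra! hcon
      exact hne (Finset.ext hcon)
    refine ⟨blocks [List.ofFn x], ?_⟩
    rw [hmem, hmem]
    tauto
  rw [Fintype.card_finset, Fintype.card_fun, Fintype.card_bool, Fintype.card_fin] at hcard
  exact ((Nat.pow_le_pow_iff_right (by norm_num)).1 hcard).trans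
    R.precision_mul_dim_le_length_encode

theorem canBeExpMoreSuccinct_uhat_rnn : CanBeExpMoreSuccinct uhatClass rnnClass := by
  rintro f ⟨g, hg, hf⟩
  obtain ⟨a, b, hb, hsize⟩ := exists_length_encode_freshWindowUHAT
  have hb' : (0 : ℝ) < b := by exact_mod_cast hb
  obtain ⟨n₀, hn₀⟩ := Filter.eventually_atTop.1
    (hg.bound (show (0 : ℝ) < 1 / (2 * b) by positivity))
  -- The size `n = a + b * (N + 1)` must be at least `n₀` and satisfy `n / (2 * b) < N`, that is, `a
  -- + b < b * N`.
  obtain ⟨N, hN⟩ : ∃ N, N = a + b + n₀ + 1 := ⟨_, rfl⟩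
  refine ⟨3, freshWindowUHAT (N + 1), fun R hR => ?_⟩
  have hle : (2 : ℝ) ^ N ≤ (rnnClass.size R : ℝ) := by
    exact_mod_cast R.2.two_pow_le_size_of_lang_eq hR
  refine lt_of_lt_of_le ?_ hle
  have hs : uhatClass.size (freshWindowUHAT (N + 1)) = a + b * (N + 1) := hsize _
  rw [hs]
  have hbN : N + 1 ≤ b * (N + 1) := Nat.le_mul_of_pos_left _ hb
  have hgn := hn₀ (a + b * (N + 1)) (by omega)
  rw [Real.norm_eq_abs, Real.norm_eq_abs, Nat.abs_cast] at hgn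
  refine (hf _).trans_lt ?_
  rw [← Real.rpow_natCast]
  refine Real.rpow_lt_rpow_of_exponent_lt (by norm_num) ?_
  refine ((le_abs_self _).trans hgn).trans_lt ?_
  rw [one_div_mul_eq_div, div_lt_iff₀ (by positivity)]
  have hlt : a + b * (N + 1) < N * (2 * b) := by
    have : N ≤ b * N := Nat.le_mul_of_pos_left _ hb
    rw [mul_add, mul_one, show N * (2 * b) = b * N + b * N by ring]
    omega
  exact_mod_cast hlt

end Succinct

theorem mainTheorem5 :
    (∀ (F : Succinct.RNNFormat) (σ : ℕ) (R : Succinct.RNN F σ),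
      ∃ A : DFA (Fin σ) (Fin (2 ^ (R.precision * R.dim))), A.accepts = R.lang) ∧
    Succinct.CanBeExpMoreSuccinct Succinct.uhatClass Succinct.rnnClass :=
  ⟨fun _ _ R => R.exists_dfa, Succinct.canBeExpMoreSuccinct_uhat_rnn⟩
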